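/- For $\alpha\in\mathbb C$ and $f:\mathbb C\to\mathbb C$ write $U_\alpha f(z)=e^{-\frac12|\alpha|^2+\bar\alpha z}f(z-\alpha)$. Let $\mathcal F(\mathbb C)$ be the Bargmann-Fock space of all entire functions $f$ with $\|f\|^2=\frac1\pi\int_{\mathbb C}|f(z)|^2e^{-|z|^2}\,dx\,dy<\infty$ (where $z=x+iy$). Let $\mathcal E$ be either the set of even nonnegative integers or the set of odd positive integers, let $\mathcal E^c=\{0,1,2,\ldots\}\setminus\mathcal E$, and let $\beta\in\mathbb C$ with $\beta\ne0$. Then: 1. (No deep interpolation.) There are complex numbers $(a_j)_{j\in\mathcal E}$ and $(b_j)_{j\in\mathcal E^c}$ with $$\sum_{j\in\mathcal E}\frac{|a_j|^2}{j!}+\sum_{j\in\mathcal E^c}\frac{|b_j|^2}{j!}<\infty$$ for which no $f\in\mathcal F(\mathbb C)$ satisfies both $f^{(j)}(0)=a_j$ for all $j\in\mathcal E$ and $(U_\beta f)^{(j)}(0)=b_j$ for all $j\in\mathcal E^c$. 2. (No deep sampling.) There is no constant $\epsilon>0$ such that $$\sum_{j\in\mathcal E}\frac{|f^{(j)}(0)|^2}{j!}+\sum_{j\in\mathcal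 E^c}\frac{|(U_\beta f)^{(j)}(0)|^2}{j!}\ \ge\ \epsilon\,\|f\|^2\qquad\text{for all } f\in\mathcal F(\mathbb C).$$ -/

import Mathlib

open MeasureTheory
open scoped ENNReal Nat ComplexConjugate

noncomputable section

namespace DeepZero

/-- The Gaussian measure `dμ_G(z) = π⁻¹ e^{-|z|²} dx dy` on `ℂ`. -/
def gaussianMeasure : Measure ℂ :=
  volume.withDensity fun z => ENNReal.ofReal (Real.pi⁻¹ * Real.exp (-‖z‖ ^ 2))

/-- The squared Bargmann-Fock norm `‖f‖² = ∫ |f|² dμ_G`, with values in `[0, ∞]`. -/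
def fockNormSq (f : ℂ → ℂ) : ℝ≥0∞ :=
  ∫⁻ z, ‖f z‖ₑ ^ 2 ∂gaussianMeasure

/-- The Bargmann-Fock space: entire functions of finite norm. -/
def Fock : Set (ℂ → ℂ) :=
  {f | Differentiable ℂ f ∧ fockNormSq f < ∞}

/-- The Fock translate `U_α f(z) = e^{-|α|²/2 + conj(α) z} f(z - α)`. -/
def fockTranslate (α : ℂ) (f : ℂ → ℂ) : ℂ → ℂ :=
  fun z => Complex.exp (-(1 / 2 : ℂ) * (‖α‖ : ℂ) ^ 2 + conj α * z) * f (z - α)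

/-- Deep interpolation for `(E, β)`: all data `(a_j)_{j ∈ E}`, `(b_j)_{j ∉ E}` with
`∑_{j ∈ E} |a_j|²/j! + ∑_{j ∉ E} |b_j|²/j! < ∞` are of the form `a_j = f⁽ʲ⁾(0)`,
`b_j = (U_β f)⁽ʲ⁾(0)` for some `f` in the Fock space. -/
def IsDeepInterpolation (E : Set ℕ) (β : ℂ) : Prop :=
  ∀ (a : E → ℂ) (b : (Eᶜ : Set ℕ) → ℂ),
    (Summable fun j : E => ‖a j‖ ^ 2 / ((j : ℕ)! : ℝ)) →
    (Summable fun j : (Eᶜ : Set ℕ) => ‖b j‖ ^ 2 / ((j : ℕ)! : ℝ)) →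
    ∃ f ∈ Fock,
      (∀ j : E, iteratedDeriv (j : ℕ) f 0 = a j) ∧
      (∀ j : (Eᶜ : Set ℕ), iteratedDeriv (j : ℕ) (fockTranslate β f) 0 = b j)

/-- The squared seminorm
`‖f‖²_{E,β} = ∑_{j ∈ E} |f⁽ʲ⁾(0)|²/j! + ∑_{j ∉ E} |(U_β f)⁽ʲ⁾(0)|²/j!`, in `[0, ∞]`. -/
def deepNormSq (E : Set ℕ) (β : ℂ) (f : ℂ → ℂ) : ℝ≥0∞ :=
  (∑' j : E, ‖iteratedDeriv (j : ℕ) f 0‖ₑ ^ 2 / ((j : ℕ)! : ℝ≥0∞)) +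
    ∑' j : (Eᶜ : Set ℕ),
      ‖iteratedDeriv (j : ℕ) (fockTranslate β f) 0‖ₑ ^ 2 / ((j : ℕ)! : ℝ≥0∞)

/-- Deep sampling for `(E, β)`: `‖f‖²_{E,β} ≥ ε ‖f‖²` on the Fock space, for some real `ε > 0`. -/
def IsDeepSampling (E : Set ℕ) (β : ℂ) : Prop :=
  ∃ ε : ℝ, 0 < ε ∧ ∀ f ∈ Fock, ENNReal.ofReal ε * fockNormSq f ≤ deepNormSq E β f

end DeepZero

end

noncomputable section

namespace DeepZero

/-! Rotating the plane, take `β = b > 0`, and let `c * b = π / 2`. The function `exp (u ^ 2 / 2) *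
cos (c * u - k * π / 2)` has parity `k`, and `U_b` shifts its cosine by a quarter period, giving a
function of parity `k + 1`. It just misses the Fock space, since its weighted modulus does not decay
along the real axis. Damping it to `exp ((1 - d) * u ^ 2 / 2)` puts it in the space for `0 < d ≤ 1`.
Its `k`-th derivative at `0` is still `c ^ k` for `k < 2`, while the parity-`k` part of its
translate tends to `0` in norm as `d → 0` (`exists_small_parityPart`).

Sampling fails when `E` has parity opposite to `k`: for these functions the deep norm sees only that
small part, but the Fock norm stays bounded below.

Interpolation fails by duality when `E` has parity `k`: prescribe the data of `z ^ k` on `E` and `0`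
on the complement. For a solution `F`, the pairing of `F` with a test function is a fixed nonzero
number. As `U_β` is unitary and `U_β F` has parity `k`, the pairing also sees only the small part of
the translated test function, so Cauchy–Schwarz gives a contradiction. -/

/-! ### Gaussian integrals and their symmetries -/

theorem measurable_gaussianDensity :
    Measurable fun z : ℂ => ENNReal.ofReal (Real.pi⁻¹ * Real.exp (-‖z‖ ^ 2)) := by
  fun_prop

theorem fockNormSq_eq_lintegral (f : ℂ → ℂ) :
    fockNormSq f =
      ∫⁻ z, ENNReal.ofReal (Real.pi⁻¹ * (Real.exp (-‖z‖ ^ 2) * ‖f z‖ ^ 2)) := by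
  unfold fockNormSq gaussianMeasure
  rw [lintegral_withDensity_eq_lintegral_mul_non_measurable _ measurable_gaussianDensity
    (by simp)]
  refine lintegral_congr fun z => ?_
  rw [Pi.mul_apply, ← ofReal_norm, ← ENNReal.ofReal_pow (norm_nonneg _),
    ← ENNReal.ofReal_mul (by positivity), mul_assoc]

theorem integral_gaussianMeasure (f : ℂ → ℂ) :
    ∫ z, f z ∂gaussianMeasure =
      ∫ z, ((Real.pi⁻¹ * Real.exp (-‖z‖ ^ 2) : ℝ) : ℂ) * f z := by
  unfold gaussianMeasure
  rw [integral_withDensity_eq_integral_toReal_smul measurable_gaussianDensity (by simp)]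
  refine integral_congr_ae (Filter.Eventually.of_forall fun z => ?_)
  simp only
  rw [ENNReal.toReal_ofReal (by positivity), Complex.real_smul]

/-- An anisotropic Gaussian bound on `|f|² e^{-|z|²}` bounds the Fock norm. -/
theorem fockNormSq_le_of_gaussian_bound {f : ℂ → ℂ} {C p q : ℝ} (hC : 0 ≤ C) (hp : 0 < p)
    (hq : 0 < q)
    (h : ∀ z : ℂ, Real.exp (-‖z‖ ^ 2) * ‖f z‖ ^ 2 ≤
      C * (Real.exp (-p * z.re ^ 2) * Real.exp (-q * z.im ^ 2))) :
    fockNormSq f ≤ ENNReal.ofReal (C * (Real.sqrt p)⁻¹ * (Real.sqrt q)⁻¹) := by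
  have gauss : ∀ r : ℝ, 0 < r →
      ∫⁻ x : ℝ, ENNReal.ofReal (Real.exp (-r * x ^ 2)) = ENNReal.ofReal (√(Real.pi / r)) := by
    intro r hr
    rw [← integral_gaussian, ofReal_integral_eq_lintegral_ofReal (integrable_exp_neg_mul_sq hr)]
    exact Filter.Eventually.of_forall fun x => (Real.exp_pos _).le
  rw [fockNormSq_eq_lintegral]
  calc _ ≤ ∫⁻ z : ℂ, ENNReal.ofReal (Real.pi⁻¹ * C) *
          (ENNReal.ofReal (Real.exp (-p * z.re ^ 2)) *
            ENNReal.ofReal (Real.exp (-q * z.im ^ 2))) := by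
        refine lintegral_mono fun z => ?_
        rw [← ENNReal.ofReal_mul (Real.exp_pos _).le, ← ENNReal.ofReal_mul (by positivity)]
        refine ENNReal.ofReal_le_ofReal ?_
        rw [mul_assoc]
        exact mul_le_mul_of_nonneg_left (h z) (by positivity)
    _ = ENNReal.ofReal (Real.pi⁻¹ * C) * ∫⁻ w : ℝ × ℝ,
          (ENNReal.ofReal (Real.exp (-p * w.1 ^ 2)) *
            ENNReal.ofReal (Real.exp (-q * w.2 ^ 2))) := by
        rw [lintegral_const_mul' _ _ ENNReal.ofReal_ne_top]
        congr 1
        exact Complex.volume_preserving_equiv_real_prod.lintegral_comp_emb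
          Complex.measurableEquivRealProd.measurableEmbedding
          (fun w : ℝ × ℝ => ENNReal.ofReal (Real.exp (-p * w.1 ^ 2)) *
            ENNReal.ofReal (Real.exp (-q * w.2 ^ 2)))
    _ = ENNReal.ofReal (C * (Real.sqrt p)⁻¹ * (Real.sqrt q)⁻¹) := by
        rw [Measure.volume_eq_prod, lintegral_prod_mul
          (f := fun x : ℝ => ENNReal.ofReal (Real.exp (-p * x ^ 2)))
          (g := fun y : ℝ => ENNReal.ofReal (Real.exp (-q * y ^ 2)))
          (by fun_prop) (by fun_prop), gauss p hp,
          gauss q hq, ← ENNReal.ofReal_mul (by positivity), ← ENNReal.ofReal_mul (by positivity),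
          Real.sqrt_div Real.pi_pos.le, Real.sqrt_div Real.pi_pos.le]
        congr 1
        have := Real.mul_self_sqrt Real.pi_pos.le
        have h0 : Real.pi ≠ 0 := Real.pi_ne_zero
        have h1 : √p ≠ 0 := by positivity
        have h2 : √q ≠ 0 := by positivity
        field_simp
        nlinarith

theorem fockNormSq_comp_rotation (ω : Circle) (f : ℂ → ℂ) :
    fockNormSq (fun z => f (ω * z)) = fockNormSq f := by
  rw [fockNormSq_eq_lintegral, fockNormSq_eq_lintegral]
  rw [← (rotation ω).measurePreserving.lintegral_comp_emb
    (rotation ω).toHomeomorph.measurableEmbedding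
    (fun z => ENNReal.ofReal (Real.pi⁻¹ * (Real.exp (-‖z‖ ^ 2) * ‖f z‖ ^ 2)))]
  refine lintegral_congr fun z => ?_
  simp [rotation_apply, Circle.norm_coe]

theorem integral_gaussianMeasure_comp_neg (f : ℂ → ℂ) :
    ∫ z, f (-z) ∂gaussianMeasure = ∫ z, f z ∂gaussianMeasure := by
  rw [integral_gaussianMeasure, integral_gaussianMeasure,
    ← integral_neg_eq_self (fun z => ((Real.pi⁻¹ * Real.exp (-‖z‖ ^ 2) : ℝ) : ℂ) * f z)]
  simp

theorem fockNormSq_comp_neg (f : ℂ → ℂ) : fockNormSq (fun z => f (-z)) = fockNormSq f := by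
  rw [fockNormSq_eq_lintegral, fockNormSq_eq_lintegral,
    ← lintegral_neg_eq_self
      (fun z => ENNReal.ofReal (Real.pi⁻¹ * (Real.exp (-‖z‖ ^ 2) * ‖f z‖ ^ 2)))]
  simp

/-! ### Unitarity of the translations -/

theorem norm_sq_fock_weight (β z : ℂ) :
    -‖z‖ ^ 2 + (2 * (conj β * z).re - ‖β‖ ^ 2) = -‖z - β‖ ^ 2 := by
  simp only [Complex.sq_norm, Complex.normSq_apply, Complex.mul_re, Complex.conj_re,
    Complex.conj_im, Complex.sub_re, Complex.sub_im]
  ring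

theorem norm_fockTranslate (β : ℂ) (f : ℂ → ℂ) (z : ℂ) :
    ‖fockTranslate β f z‖ =
      Real.exp ((conj β * z).re - ‖β‖ ^ 2 / 2) * ‖f (z - β)‖ := by
  unfold fockTranslate
  rw [norm_mul, Complex.norm_exp]
  congr 2
  have : (-(1 / 2 : ℂ) * (‖β‖ : ℂ) ^ 2).re = -‖β‖ ^ 2 / 2 := by
    rw [show (-(1 / 2 : ℂ) * (‖β‖ : ℂ) ^ 2) = ((-‖β‖ ^ 2 / 2 : ℝ) : ℂ) by push_cast; ring]
    exact Complex.ofReal_re _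
  rw [Complex.add_re, this]
  ring

theorem fockNormSq_fockTranslate (β : ℂ) (f : ℂ → ℂ) :
    fockNormSq (fockTranslate β f) = fockNormSq f := by
  rw [fockNormSq_eq_lintegral, fockNormSq_eq_lintegral,
    ← lintegral_sub_right_eq_self
      (fun z => ENNReal.ofReal (Real.pi⁻¹ * (Real.exp (-‖z‖ ^ 2) * ‖f z‖ ^ 2))) β]
  refine lintegral_congr fun z => ?_
  rw [norm_fockTranslate, mul_pow, ← mul_assoc (Real.exp _), ← Real.exp_nat_mul, ← Real.exp_add,
    ← norm_sq_fock_weight]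
  congr 5
  push_cast
  ring

theorem integral_fockTranslate_mul_conj (β : ℂ) (f g : ℂ → ℂ) :
    ∫ z, fockTranslate β f z * conj (fockTranslate β g z) ∂gaussianMeasure =
      ∫ z, f z * conj (g z) ∂gaussianMeasure := by
  rw [integral_gaussianMeasure, integral_gaussianMeasure,
    ← integral_sub_right_eq_self
      (fun z => ((Real.pi⁻¹ * Real.exp (-‖z‖ ^ 2) : ℝ) : ℂ) * (f z * conj (g z))) β]
  refine integral_congr_ae (Filter.Eventually.of_forall fun z => ?_)
  simp only [fockTranslate, map_mul]
  rw [← norm_sq_fock_weight, Real.exp_add, mul_mul_mul_comm (Complex.exp _), Complex.mul_conj,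
    Complex.normSq_eq_norm_sq, Complex.norm_exp, ← Real.exp_nat_mul]
  have : (-(1 / 2 : ℂ) * (‖β‖ : ℂ) ^ 2).re = -‖β‖ ^ 2 / 2 := by
    rw [show (-(1 / 2 : ℂ) * (‖β‖ : ℂ) ^ 2) = ((-‖β‖ ^ 2 / 2 : ℝ) : ℂ) by push_cast; ring]
    exact Complex.ofReal_re _
  rw [Complex.add_re, this, show ((2 : ℕ) : ℝ) * (-‖β‖ ^ 2 / 2 + (conj β * z).re) =
    2 * (conj β * z).re - ‖β‖ ^ 2 by push_cast; ring]
  push_cast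
  ring

/-! ### The Fock space inside `L²` -/

theorem Fock.memLp {f : ℂ → ℂ} (hf : f ∈ Fock) : MemLp f 2 gaussianMeasure := by
  refine ⟨hf.1.continuous.aestronglyMeasurable, ?_⟩
  rw [eLpNorm_lt_top_iff_lintegral_rpow_enorm_lt_top (by norm_num) (by norm_num)]
  simpa [fockNormSq] using hf.2

theorem fockTranslate_mem_fock {f : ℂ → ℂ} (hf : f ∈ Fock) (β : ℂ) :
    fockTranslate β f ∈ Fock := by
  refine ⟨?_, by rw [fockNormSq_fockTranslate]; exact hf.2⟩
  have := hf.1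
  unfold fockTranslate
  fun_prop

theorem comp_neg_mem_fock {f : ℂ → ℂ} (hf : f ∈ Fock) : (fun z => f (-z)) ∈ Fock := by
  refine ⟨?_, by rw [fockNormSq_comp_neg]; exact hf.2⟩
  have := hf.1
  fun_prop

theorem mem_fock_of_memLp {f : ℂ → ℂ} (hd : Differentiable ℂ f) (hf : MemLp f 2 gaussianMeasure) :
    f ∈ Fock := by
  refine ⟨hd, ?_⟩
  have := hf.2
  rw [eLpNorm_lt_top_iff_lintegral_rpow_enorm_lt_top (by norm_num) (by norm_num)] at this
  simpa [fockNormSq] using this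

theorem Fock.integrable_mul_conj {f g : ℂ → ℂ} (hf : f ∈ Fock) (hg : g ∈ Fock) :
    Integrable (fun z => f z * conj (g z)) gaussianMeasure :=
  (Fock.memLp hf).integrable_mul (Fock.memLp hg).star

theorem toReal_fockNormSq {f : ℂ → ℂ} (hf : f ∈ Fock) :
    (fockNormSq f).toReal = ‖(Fock.memLp hf).toLp f‖ ^ 2 := by
  rw [Lp.norm_toLp, eLpNorm_eq_lintegral_rpow_enorm_toReal (by norm_num) (by norm_num),
    ← ENNReal.toReal_pow]
  congr 1
  simp only [ENNReal.toReal_ofNat, one_div, ENNReal.rpow_ofNat]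
  rw [← ENNReal.rpow_natCast, ← ENNReal.rpow_mul]
  simp [fockNormSq]

theorem inner_toLp_fock {f g : ℂ → ℂ} (hf : f ∈ Fock) (hg : g ∈ Fock) :
    inner ℂ ((Fock.memLp hg).toLp g) ((Fock.memLp hf).toLp f) =
      ∫ z, f z * conj (g z) ∂gaussianMeasure := by
  rw [L2.inner_def]
  refine integral_congr_ae ?_
  filter_upwards [(Fock.memLp hg).coeFn_toLp, (Fock.memLp hf).coeFn_toLp] with z h1 h2
  rw [h1, h2, RCLike.inner_apply]

theorem norm_integral_mul_conj_sq_le {f g : ℂ → ℂ} (hf : f ∈ Fock) (hg : g ∈ Fock) :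
    ‖∫ z, f z * conj (g z) ∂gaussianMeasure‖ ^ 2 ≤
      (fockNormSq f).toReal * (fockNormSq g).toReal := by
  rw [← inner_toLp_fock hf hg, toReal_fockNormSq hf, toReal_fockNormSq hg, ← mul_pow]
  gcongr
  rw [mul_comm]
  exact norm_inner_le_norm _ _

theorem pow_mem_fock (n : ℕ) : (fun z : ℂ => z ^ n) ∈ Fock := by
  refine ⟨by fun_prop, lt_of_le_of_lt (fockNormSq_le_of_gaussian_bound (C := 2 ^ n * n !)
    (p := 1 / 2) (q := 1 / 2) (by positivity) (by norm_num) (by norm_num) fun z => ?_)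
    ENNReal.ofReal_lt_top⟩
  -- Half of the Gaussian absorbs the power; the other half gives `p = q = 1 / 2`.
  have h := Real.pow_div_factorial_le_exp (x := ‖z‖ ^ 2 / 2) (by positivity) n
  rw [div_le_iff₀ (by positivity)] at h
  have hz : ‖z‖ ^ 2 = z.re ^ 2 + z.im ^ 2 := by
    rw [Complex.sq_norm, Complex.normSq_apply]; ring
  calc Real.exp (-‖z‖ ^ 2) * ‖z ^ n‖ ^ 2
      = 2 ^ n * (Real.exp (-‖z‖ ^ 2) * (‖z‖ ^ 2 / 2) ^ n) := by
        rw [norm_pow, div_pow]; field_simp; ring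
    _ ≤ 2 ^ n * (Real.exp (-‖z‖ ^ 2) * (Real.exp (‖z‖ ^ 2 / 2) * n !)) := by gcongr
    _ = _ := by
        rw [← Real.exp_add, ← mul_assoc (Real.exp _), ← Real.exp_add, hz,
          show -(z.re ^ 2 + z.im ^ 2) + (z.re ^ 2 + z.im ^ 2) / 2 =
            -(1 / 2) * z.re ^ 2 + -(1 / 2) * z.im ^ 2 by ring]
        ring

/-! ### Taylor coefficients as inner products with monomials -/

theorem integral_eq_zero_of_forall_circle {f : ℂ → ℂ}
    (h : ∀ r : ℝ, 0 < r → ∫ θ in (0 : ℝ)..2 * Real.pi, f (circleMap 0 r θ) = 0) :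
    ∫ z, f z = 0 := by
  rw [← Complex.integral_comp_polarCoord_symm, polarCoord_target]
  by_cases hi : IntegrableOn (fun p : ℝ × ℝ => p.1 • f (Complex.polarCoord.symm p))
      (Set.Ioi (0 : ℝ) ×ˢ Set.Ioo (-Real.pi) Real.pi)
  · rw [Measure.volume_eq_prod] at hi ⊢
    rw [setIntegral_prod _ hi]
    refine (setIntegral_congr_fun measurableSet_Ioi fun r hr => ?_).trans
      (integral_zero _ _)
    simp only
    rw [integral_smul, ← integral_Ioc_eq_integral_Ioo,
      ← intervalIntegral.integral_of_le (by linarith [Real.pi_pos])]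
    have hp : Function.Periodic (fun θ => f (circleMap 0 r θ)) (2 * Real.pi) := fun θ => by
      simp only [periodic_circleMap 0 r θ]
    have := hp.intervalIntegral_add_eq (-Real.pi) 0
    rw [zero_add, h r hr, show -Real.pi + 2 * Real.pi = Real.pi by ring] at this
    rw [← smul_zero r, ← this]
    congr 2
    funext θ
    congr 1
    simp [circleMap, Complex.exp_mul_I]
  -- Without integrability the integral is `0` by convention.
  · exact integral_undef hi

/-- On the circle `conj w = r ^ 2 / w`, which turns the integral into Cauchy's formula for the
`n`-th derivative. -/
theorem integral_circle_mul_conj_pow {f : ℂ → ℂ} (hf : Differentiable ℂ f) (n : ℕ) {r : ℝ}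
    (hr : 0 < r) :
    ∫ θ in (0 : ℝ)..2 * Real.pi, f (circleMap 0 r θ) * conj (circleMap 0 r θ ^ n) =
      2 * Real.pi * ((r : ℂ) ^ (2 * n) * (iteratedDeriv n f 0 / n !)) := by
  have h := DiffContOnCl.circleIntegral_one_div_sub_center_pow_smul (c := 0) hr n
    (hf.diffContOnCl)
  rw [circleIntegral] at h
  have key : ∀ θ : ℝ, f (circleMap 0 r θ) * conj (circleMap 0 r θ ^ n) =
      (r : ℂ) ^ (2 * n) / Complex.I * (deriv (circleMap 0 r) θ •
        ((1 / (circleMap 0 r θ - 0) ^ (n + 1)) • f (circleMap 0 r θ))) := by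
    intro θ
    have h0 : circleMap 0 r θ ≠ 0 := circleMap_ne_center hr.ne'
    have h1 : circleMap 0 r θ * conj (circleMap 0 r θ) = (r : ℂ) ^ 2 := by
      rw [Complex.mul_conj, Complex.normSq_eq_norm_sq, norm_circleMap_zero]
      simp
    rw [deriv_circleMap, pow_mul, ← h1, mul_pow, map_pow]
    simp only [smul_eq_mul, sub_zero]
    field_simp
    ring
  simp_rw [key]
  rw [intervalIntegral.integral_const_mul, h]
  simp only [smul_eq_mul]
  field_simp

theorem integral_norm_pow_gaussianMeasure (n : ℕ) :
    ∫ z, ((‖z‖ : ℂ) ^ (2 * n)) ∂gaussianMeasure = n ! := by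
  rw [integral_gaussianMeasure]
  have h := Complex.integral_rpow_mul_exp_neg_rpow (p := 2) (q := (2 * n : ℕ)) (by norm_num)
    (by have : (0 : ℝ) ≤ (2 * n : ℕ) := Nat.cast_nonneg _
        linarith)
  rw [show (((2 * n : ℕ) : ℝ) + 2) / 2 = n + 1 by push_cast; ring, Real.Gamma_nat_eq_factorial] at h
  have : ∀ z : ℂ, ((Real.pi⁻¹ * Real.exp (-‖z‖ ^ 2) : ℝ) : ℂ) * (‖z‖ : ℂ) ^ (2 * n) =
      ((Real.pi⁻¹ * (‖z‖ ^ (((2 * n : ℕ) : ℝ)) * Real.exp (-‖z‖ ^ (2 : ℝ))) : ℝ) : ℂ) := by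
    intro z
    rw [Real.rpow_natCast, Real.rpow_ofNat]
    push_cast
    ring
  simp_rw [this]
  rw [integral_complex_ofReal, integral_const_mul, h]
  have h0 := Real.pi_ne_zero
  rw [show Real.pi⁻¹ * (2 * Real.pi / 2 * (n ! : ℝ)) = (n ! : ℝ) by field_simp]
  simp

theorem integral_mul_conj_pow {f : ℂ → ℂ} (hf : f ∈ Fock) (n : ℕ) :
    ∫ z, f z * conj (z ^ n) ∂gaussianMeasure = iteratedDeriv n f 0 := by
  have hi := Fock.integrable_mul_conj hf (pow_mem_fock n)
  have hn : Integrable (fun z : ℂ => (‖z‖ : ℂ) ^ (2 * n) * (iteratedDeriv n f 0 / n !))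
      gaussianMeasure := by
    refine Integrable.mul_const ?_ _
    refine (Fock.integrable_mul_conj (pow_mem_fock n) (pow_mem_fock n)).congr
      (Filter.Eventually.of_forall fun z => ?_)
    simp only
    rw [Complex.mul_conj, Complex.normSq_eq_norm_sq, norm_pow, ← pow_mul, mul_comm n]
    push_cast
    rfl
  -- The two terms have the same mean over every circle about `0`, so only the moment of `‖z‖ ^ (2 *
  -- n)` remains to be known.
  have h0 : ∫ z, (f z * conj (z ^ n) - (‖z‖ : ℂ) ^ (2 * n) * (iteratedDeriv n f 0 / n !))
      ∂gaussianMeasure = 0 := by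
    rw [integral_gaussianMeasure]
    refine integral_eq_zero_of_forall_circle fun r hr => ?_
    simp only [norm_circleMap_zero, abs_of_pos hr]
    rw [intervalIntegral.integral_const_mul, intervalIntegral.integral_sub,
      integral_circle_mul_conj_pow hf.1 n hr, intervalIntegral.integral_const]
    · simp
    · refine Continuous.intervalIntegrable ?_ _ _
      have := hf.1.continuous
      exact (this.comp (continuous_circleMap 0 r)).mul
        (Complex.continuous_conj.comp ((continuous_circleMap 0 r).pow n))
    · exact intervalIntegrable_const
  rw [integral_sub hi hn, integral_mul_const, integral_norm_pow_gaussianMeasure,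
    mul_div_cancel₀ _ (by exact_mod_cast n.factorial_ne_zero), sub_eq_zero] at h0
  exact h0

/-- Bessel's inequality for the normalized monomials. -/
theorem tsum_enorm_iteratedDeriv_sq_le {f : ℂ → ℂ} (hf : f ∈ Fock) :
    ∑' n : ℕ, ‖iteratedDeriv n f 0‖ₑ ^ 2 / (n ! : ℝ≥0∞) ≤ fockNormSq f := by
  set m : ℕ → Lp ℂ 2 gaussianMeasure := fun n => (Fock.memLp (pow_mem_fock n)).toLp _ with hm
  set e : ℕ → Lp ℂ 2 gaussianMeasure := fun n => ((√(n ! : ℝ))⁻¹ : ℂ) • m n with he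
  have hmm : ∀ i j, inner ℂ (m i) (m j) = if i = j then (j ! : ℂ) else 0 := by
    intro i j
    rw [hm, inner_toLp_fock (pow_mem_fock j) (pow_mem_fock i),
      integral_mul_conj_pow (pow_mem_fock j)]
    rw [iteratedDeriv_fun_pow_zero]
    split_ifs <;> simp_all
  have hs : ∀ n : ℕ, ((√(n ! : ℝ) : ℝ) : ℂ) ≠ 0 := fun n => by
    have : (0 : ℝ) < √(n ! : ℝ) := Real.sqrt_pos.2 (by positivity)
    exact_mod_cast this.ne'
  have hsq : ∀ n : ℕ, ((√(n ! : ℝ) : ℝ) : ℂ) * ((√(n ! : ℝ) : ℝ) : ℂ) = (n ! : ℂ) := fun n => by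
    rw [← Complex.ofReal_mul, Real.mul_self_sqrt (by positivity)]
    simp
  have hon : Orthonormal ℂ e := by
    rw [orthonormal_iff_ite]
    intro i j
    rw [he]
    simp only
    rw [inner_smul_left, inner_smul_right, hmm]
    split_ifs with hij
    · subst hij
      rw [← hsq i]
      have := hs i
      simp only [map_inv₀, Complex.conj_ofReal]
      field_simp
    · simp
  have hef : ∀ n, ‖inner ℂ (e n) ((Fock.memLp hf).toLp f)‖ ^ 2 =
      ‖iteratedDeriv n f 0‖ ^ 2 / n ! := by
    intro n
    rw [he]
    simp only
    rw [inner_smul_left, hm, inner_toLp_fock hf (pow_mem_fock n), integral_mul_conj_pow hf,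
      norm_mul, mul_pow]
    simp only [map_inv₀, Complex.conj_ofReal, norm_inv, Complex.norm_real, inv_pow,
      Real.norm_eq_abs, sq_abs]
    rw [Real.sq_sqrt (by positivity)]
    field_simp
  refine ENNReal.summable.tsum_le_of_sum_le fun s => ?_
  have hb := hon.sum_inner_products_le (s := s) ((Fock.memLp hf).toLp f)
  simp_rw [hef] at hb
  rw [← toReal_fockNormSq hf] at hb
  rw [← ENNReal.ofReal_toReal hf.2.ne]
  refine le_trans (le_of_eq ?_) (ENNReal.ofReal_le_ofReal hb)
  rw [ENNReal.ofReal_sum_of_nonneg fun _ _ => by positivity]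
  refine Finset.sum_congr rfl fun n _ => ?_
  rw [ENNReal.ofReal_div_of_pos (by positivity), ENNReal.ofReal_pow (norm_nonneg _), ofReal_norm,
    ENNReal.ofReal_natCast]

/-! ### Quasi-periodic test functions -/

theorem norm_cos_le_exp_abs_im (u : ℂ) : ‖Complex.cos u‖ ≤ Real.exp |u.im| := by
  rw [Complex.cos, norm_div]
  have h := norm_add_le (Complex.exp (u * Complex.I)) (Complex.exp (-u * Complex.I))
  rw [Complex.norm_exp, Complex.norm_exp] at h
  simp only [Complex.mul_I_re, Complex.neg_im, neg_neg] at h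
  have h1 : Real.exp (-u.im) ≤ Real.exp |u.im| := Real.exp_le_exp.2 (neg_le_abs _)
  have h2 : Real.exp (u.im) ≤ Real.exp |u.im| := Real.exp_le_exp.2 (le_abs_self _)
  rw [show ‖(2 : ℂ)‖ = 2 by simp, div_le_iff₀ (by norm_num)]
  linarith

theorem sinh_sq_le (x : ℝ) : Real.sinh x ^ 2 ≤ x ^ 2 * Real.exp (2 * |x|) := by
  have h0 : ∀ t : ℝ, 0 ≤ t → Real.sinh t ≤ t * Real.exp t := fun t ht => by
    -- `sinh t = exp t * (1 - exp (-2 * t)) / 2`, and `1 - exp (-2 * t) ≤ 2 * t`.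
    have h1 := Real.add_one_le_exp (-(2 * t))
    have h2 : Real.exp (-t) = Real.exp t * Real.exp (-(2 * t)) := by
      rw [← Real.exp_add]; ring_nf
    rw [Real.sinh_eq, h2]
    nlinarith [Real.exp_pos t]
  have h := h0 |x| (abs_nonneg x)
  have h3 : 0 ≤ Real.sinh |x| := Real.sinh_nonneg_iff.2 (abs_nonneg x)
  have h4 : Real.sinh x ^ 2 = Real.sinh |x| ^ 2 := by
    rcases abs_choice x with hx | hx <;> rw [hx]
    rw [Real.sinh_neg, neg_sq]
  rw [h4, two_mul, Real.exp_add]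
  calc Real.sinh |x| ^ 2 ≤ (|x| * Real.exp |x|) ^ 2 := by gcongr
    _ = _ := by rw [mul_pow, sq_abs]; ring

theorem norm_sinh_sq_le (w : ℂ) :
    ‖Complex.sinh w‖ ^ 2 ≤ ‖w‖ ^ 2 * Real.exp (2 * |w.re|) := by
  have h1 : ‖Complex.sinh w‖ ^ 2 = Real.sinh w.re ^ 2 + Real.sin w.im ^ 2 := by
    conv_lhs => rw [← Complex.re_add_im w, Complex.sinh_add, Complex.sinh_mul_I,
      Complex.cosh_mul_I]
    rw [← Complex.ofReal_sinh, ← Complex.ofReal_cosh, ← Complex.ofReal_sin, ← Complex.ofReal_cos,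
      Complex.sq_norm, Complex.normSq_apply]
    simp only [Complex.add_re, Complex.add_im, Complex.mul_re, Complex.mul_im, Complex.ofReal_re,
      Complex.ofReal_im, Complex.I_re, Complex.I_im]
    linear_combination Real.sinh w.re ^ 2 * Real.sin_sq_add_cos_sq w.im +
      Real.sin w.im ^ 2 * Real.cosh_sq w.re
  have h2 := sinh_sq_le w.re
  have h3 : Real.sin w.im ^ 2 ≤ w.im ^ 2 := sq_le_sq.2 Real.abs_sin_le_abs
  have h4 : 1 ≤ Real.exp (2 * |w.re|) := Real.one_le_exp (by positivity)
  have h5 : ‖w‖ ^ 2 = w.re ^ 2 + w.im ^ 2 := by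
    rw [Complex.sq_norm, Complex.normSq_apply]; ring
  rw [h1, h5]
  nlinarith [sq_nonneg w.im]

/-- Approximate solutions of `U_{2b} f = -f`, of parity `k`. -/
def quasiPeriodic (c d : ℝ) (k : ℕ) (u : ℂ) : ℂ :=
  Complex.exp ((1 - d) * u ^ 2 / 2) * Complex.cos (c * u - k * Real.pi / 2)

theorem differentiable_quasiPeriodic (c d : ℝ) (k : ℕ) :
    Differentiable ℂ (quasiPeriodic c d k) := by
  unfold quasiPeriodic
  fun_prop

/-- The exponent is at most `-d * x ^ 2 - (2 - d) * y ^ 2 + 2 * c * |y|`. Since `2 - d ≥ 1`, a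
quarter of `y ^ 2` can be spent on the linear term. Only the decay along the real axis degenerates
as `d → 0`. -/
theorem gaussian_mul_norm_quasiPeriodic_le {c d : ℝ} (hc : 0 ≤ c) (hd : d ≤ 1) (k : ℕ) (u : ℂ) :
    Real.exp (-‖u‖ ^ 2) * ‖quasiPeriodic c d k u‖ ^ 2 ≤
      Real.exp (4 * c ^ 2) * (Real.exp (-d * u.re ^ 2) * Real.exp (-(3 / 4) * u.im ^ 2)) := by
  have h5 : ‖u‖ ^ 2 = u.re ^ 2 + u.im ^ 2 := by
    rw [Complex.sq_norm, Complex.normSq_apply]; ring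
  have hre : ((1 - d) * u ^ 2 / 2 : ℂ).re = (1 - d) * (u.re ^ 2 - u.im ^ 2) / 2 := by
    rw [show ((1 - d) * u ^ 2 / 2 : ℂ) = (((1 - d) / 2 : ℝ) : ℂ) * u ^ 2 by push_cast; ring,
      Complex.re_ofReal_mul, sq, Complex.mul_re]
    ring
  have him : (c * u - k * Real.pi / 2 : ℂ).im = c * u.im := by
    rw [show (c * u - k * Real.pi / 2 : ℂ) = (c : ℂ) * u - ((k * Real.pi / 2 : ℝ) : ℂ) by
      push_cast; ring]
    simp
  have h1 := norm_cos_le_exp_abs_im (c * u - k * Real.pi / 2)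
  rw [him, abs_mul, abs_of_nonneg hc] at h1
  have h2 : 2 * (c * |u.im|) ≤ 4 * c ^ 2 + u.im ^ 2 / 4 := by
    nlinarith [sq_nonneg (|u.im| / 2 - 2 * c), sq_abs u.im]
  unfold quasiPeriodic
  rw [norm_mul, Complex.norm_exp, hre, mul_pow]
  calc _ ≤ Real.exp (-‖u‖ ^ 2) * (Real.exp ((1 - d) * (u.re ^ 2 - u.im ^ 2) / 2) ^ 2 *
        Real.exp (c * |u.im|) ^ 2) := by gcongr
    _ ≤ _ := by
        simp only [← Real.exp_nat_mul, ← Real.exp_add]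
        refine Real.exp_le_exp.2 ?_
        rw [h5]
        push_cast
        nlinarith [mul_nonneg (sub_nonneg.2 hd) (sq_nonneg u.im)]

theorem quasiPeriodic_mem_fock {c d : ℝ} (hc : 0 ≤ c) (hd0 : 0 < d) (hd : d ≤ 1) (k : ℕ) :
    quasiPeriodic c d k ∈ Fock :=
  ⟨differentiable_quasiPeriodic c d k, lt_of_le_of_lt
    (fockNormSq_le_of_gaussian_bound (by positivity) hd0 (by norm_num)
      (gaussian_mul_norm_quasiPeriodic_le hc hd k)) ENNReal.ofReal_lt_top⟩

theorem cos_neg_sub_nat_mul_pi_div_two (w : ℂ) (k : ℕ) :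
    Complex.cos (-w - k * Real.pi / 2) = (-1) ^ k * Complex.cos (w - k * Real.pi / 2) := by
  rw [← Complex.cos_neg, ← Complex.cos_antiperiodic.add_nat_mul_eq k]
  congr 1
  ring

theorem quasiPeriodic_neg (c d : ℝ) (k : ℕ) (u : ℂ) :
    quasiPeriodic c d k (-u) = (-1) ^ k * quasiPeriodic c d k u := by
  unfold quasiPeriodic
  rw [neg_sq, mul_neg, cos_neg_sub_nat_mul_pi_div_two]
  ring

theorem iteratedDeriv_quasiPeriodic (c d : ℝ) {k : ℕ} (hk : k < 2) :
    iteratedDeriv k (quasiPeriodic c d k) 0 = (c : ℂ) ^ k := by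
  interval_cases k
  · simp [quasiPeriodic]
  · rw [iteratedDeriv_one]
    have h1 : HasDerivAt (fun u : ℂ => Complex.exp ((1 - d) * u ^ 2 / 2)) 0 0 := by
      have := ((((hasDerivAt_id (0 : ℂ)).pow 2).const_mul ((1 - d : ℂ))).div_const 2).cexp
      simpa using this
    have h2 : HasDerivAt (fun u : ℂ => Complex.cos (c * u - (1 : ℕ) * Real.pi / 2)) c 0 := by
      have := (((hasDerivAt_id (0 : ℂ)).const_mul (c : ℂ)).sub_const
        (((1 : ℕ) * Real.pi / 2 : ℂ))).ccos
      simpa using this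
    have h3 : HasDerivAt (quasiPeriodic c d 1) _ 0 := h1.mul h2
    simpa using h3.deriv

/-- The part of parity `k` of a function on `ℂ`. -/
def parityPart (k : ℕ) (f : ℂ → ℂ) (z : ℂ) : ℂ :=
  (f z + (-1) ^ k * f (-z)) / 2

/-- The shift is a quarter period of the cosine, hence `k + 1`. The cross term of `(1 - d) * (u - b)
^ 2 / 2` cancels the translation factor up to `exp (d * b * u)`. -/
theorem fockTranslate_quasiPeriodic {b c : ℝ} (d : ℝ) (hcb : c * b = Real.pi / 2) (k : ℕ) (u : ℂ) :
    fockTranslate b (quasiPeriodic c d k) u =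
      Complex.exp (-(d * b ^ 2 / 2 : ℝ)) * quasiPeriodic c d (k + 1) u *
        Complex.exp (d * b * u) := by
  have hcb' : (c : ℂ) * b = Real.pi / 2 := by exact_mod_cast congrArg Complex.ofReal hcb
  have hb : ((‖(b : ℂ)‖ : ℝ) : ℂ) ^ 2 = (b : ℂ) ^ 2 := by
    rw [Complex.norm_real, Real.norm_eq_abs, ← Complex.ofReal_pow, sq_abs, Complex.ofReal_pow]
  unfold fockTranslate quasiPeriodic
  rw [hb, Complex.conj_ofReal, show (c : ℂ) * (u - b) - k * Real.pi / 2 =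
    c * u - ((k + 1 : ℕ) : ℂ) * Real.pi / 2 by
      push_cast
      linear_combination -hcb', ← mul_assoc, ← mul_assoc, ← Complex.exp_add, ← Complex.exp_add,
    mul_right_comm, ← Complex.exp_add]
  congr 2
  push_cast
  ring

/-- `quasiPeriodic c d (k + 1)` has the wrong parity, so only the odd part of `exp (d * b * u)`
survives. -/
theorem parityPart_fockTranslate_quasiPeriodic {b c : ℝ} (d : ℝ) (hcb : c * b = Real.pi / 2)
    (k : ℕ) (u : ℂ) :
    parityPart k (fockTranslate b (quasiPeriodic c d k)) u =
      Complex.exp (-(d * b ^ 2 / 2 : ℝ)) * quasiPeriodic c d (k + 1) u *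
        Complex.sinh (d * b * u) := by
  unfold parityPart
  rw [fockTranslate_quasiPeriodic d hcb, fockTranslate_quasiPeriodic d hcb, quasiPeriodic_neg,
    Complex.sinh, mul_neg]
  have : ((-1 : ℂ) ^ k) * (-1) ^ (k + 1) = -1 := by
    rw [← pow_add, show k + (k + 1) = 2 * k + 1 by ring, pow_succ, pow_mul]
    simp
  linear_combination (Complex.exp (-(d * b ^ 2 / 2 : ℝ)) * quasiPeriodic c d (k + 1) u *
    Complex.exp (-(d * b * u)) / 2) * this

/-- With `d = s ^ 2`, the squared `sinh` gains `s ^ 4 * ‖u‖ ^ 2`. The Gaussian absorbs `s ^ 2 * ‖u‖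
^ 2`, and integrating the remaining Gaussian along the real axis costs `1 / s`, leaving order `s`.
-/
theorem fockNormSq_parityPart_fockTranslate_le {b c s : ℝ} (hb : 0 < b) (hc : 0 < c) (hs : 0 < s)
    (hs1 : s ≤ 1) (hcb : c * b = Real.pi / 2) (k : ℕ) :
    fockNormSq (parityPart k (fockTranslate b (quasiPeriodic c (s ^ 2) k))) ≤
      ENNReal.ofReal (8 * b ^ 2 * Real.exp (4 * c ^ 2 + 2 * b ^ 2) * (√(1 / 2))⁻¹ * s) := by
  have hd : s ^ 2 ≤ 1 := pow_le_one₀ hs.le hs1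
  refine (fockNormSq_le_of_gaussian_bound
    (C := 4 * s ^ 2 * b ^ 2 * Real.exp (4 * c ^ 2 + 2 * b ^ 2))
    -- What is left of the decay rates: `s ^ 2 - s ^ 2 / 4 - s ^ 2 / 2` and `3 / 4 - 1 / 4`.
    (p := (s / 2) ^ 2) (q := 1 / 2) (by positivity) (by positivity) (by norm_num)
    fun u => ?_).trans (le_of_eq ?_)
  · rw [parityPart_fockTranslate_quasiPeriodic _ hcb, norm_mul, norm_mul, mul_pow, mul_pow,
      Complex.norm_exp]
    have h1 := gaussian_mul_norm_quasiPeriodic_le hc.le hd (k + 1) u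
    have h2 := norm_sinh_sq_le (((s ^ 2 : ℝ) : ℂ) * b * u)
    have h5 : ‖u‖ ^ 2 = u.re ^ 2 + u.im ^ 2 := by
      rw [Complex.sq_norm, Complex.normSq_apply]; ring
    rw [← Complex.ofReal_mul, norm_mul, Complex.norm_real, Complex.re_ofReal_mul, mul_pow, h5,
      Real.norm_eq_abs, sq_abs, abs_mul, abs_of_nonneg (by positivity : 0 ≤ s ^ 2 * b)] at h2
    rw [Complex.ofReal_mul] at h2
    have h3 : Real.exp ((-((s ^ 2 * b ^ 2 / 2 : ℝ) : ℂ)).re) ^ 2 ≤ 1 := by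
      refine pow_le_one₀ (Real.exp_pos _).le (Real.exp_le_one_iff.2 ?_)
      rw [Complex.neg_re, Complex.ofReal_re]
      have : 0 ≤ s ^ 2 * b ^ 2 / 2 := by positivity
      linarith
    have h4 : s ^ 2 * (u.re ^ 2 + u.im ^ 2) ≤
        4 * Real.exp (s ^ 2 * u.re ^ 2 / 4 + u.im ^ 2 / 4) := by
      have := Real.add_one_le_exp (s ^ 2 * u.re ^ 2 / 4 + u.im ^ 2 / 4)
      nlinarith [mul_nonneg (sub_nonneg.2 hd) (sq_nonneg u.im)]
    have h6 : 2 * (s ^ 2 * b * |u.re|) ≤ s ^ 2 * u.re ^ 2 / 2 + 2 * b ^ 2 := by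
      nlinarith [mul_nonneg (sq_nonneg s) (sq_nonneg (|u.re| - 2 * b)), sq_abs u.re,
        mul_nonneg (sub_nonneg.2 hd) (sq_nonneg b)]
    calc _ = Real.exp ((-((s ^ 2 * b ^ 2 / 2 : ℝ) : ℂ)).re) ^ 2 *
          ((Real.exp (-‖u‖ ^ 2) * ‖quasiPeriodic c (s ^ 2) (k + 1) u‖ ^ 2) *
            ‖Complex.sinh (((s ^ 2 : ℝ) : ℂ) * b * u)‖ ^ 2) := by ring
      _ ≤ 1 * ((Real.exp (4 * c ^ 2) * (Real.exp (-s ^ 2 * u.re ^ 2) *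
            Real.exp (-(3 / 4) * u.im ^ 2))) *
            ((s ^ 2 * b) ^ 2 * (u.re ^ 2 + u.im ^ 2) *
              Real.exp (2 * (s ^ 2 * b * |u.re|)))) := by gcongr
      _ = s ^ 2 * b ^ 2 * (Real.exp (4 * c ^ 2) * (Real.exp (-s ^ 2 * u.re ^ 2) *
            Real.exp (-(3 / 4) * u.im ^ 2))) *
            ((s ^ 2 * (u.re ^ 2 + u.im ^ 2)) * Real.exp (2 * (s ^ 2 * b * |u.re|))) := by ring
      _ ≤ s ^ 2 * b ^ 2 * (Real.exp (4 * c ^ 2) * (Real.exp (-s ^ 2 * u.re ^ 2) *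
            Real.exp (-(3 / 4) * u.im ^ 2))) *
            ((4 * Real.exp (s ^ 2 * u.re ^ 2 / 4 + u.im ^ 2 / 4)) *
              Real.exp (s ^ 2 * u.re ^ 2 / 2 + 2 * b ^ 2)) := by gcongr
      _ = 4 * s ^ 2 * b ^ 2 * (Real.exp (4 * c ^ 2) * (Real.exp (-s ^ 2 * u.re ^ 2) *
            Real.exp (-(3 / 4) * u.im ^ 2)) *
            (Real.exp (s ^ 2 * u.re ^ 2 / 4 + u.im ^ 2 / 4) *
              Real.exp (s ^ 2 * u.re ^ 2 / 2 + 2 * b ^ 2))) := by ring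
      _ = _ := by
        rw [mul_assoc (4 * s ^ 2 * b ^ 2)]
        simp only [← Real.exp_add]
        congr 2
        ring
  · rw [Real.sqrt_sq (by positivity)]
    congr 1
    field_simp
    ring

/-! ### Reduction to a positive real translation -/

theorem parityPart_comp_mul_left (k : ℕ) (f : ℂ → ℂ) (a z : ℂ) :
    parityPart k (fun w => f (a * w)) z = parityPart k f (a * z) := by
  simp [parityPart]

theorem fockTranslate_comp_rotation (ω : Circle) (b : ℝ) (f : ℂ → ℂ) :
    fockTranslate (b * ω) (fun z => f ((ω⁻¹ : Circle) * z)) =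
      fun z => fockTranslate b f ((ω⁻¹ : Circle) * z) := by
  funext z
  have h1 : ((ω⁻¹ : Circle) : ℂ) * ω = 1 := by rw [← Circle.coe_mul]; simp
  simp only [fockTranslate, mul_sub]
  rw [show ((ω⁻¹ : Circle) : ℂ) * (b * ω) = b by linear_combination (b : ℂ) * h1, norm_mul,
    Circle.norm_coe, mul_one, map_mul, ← Circle.coe_inv_eq_conj, mul_assoc]

/-- Fock functions of parity `k`, nondegenerate at the origin, whose `β`-translates have
arbitrarily small parts of the same parity `k`. -/
theorem exists_small_parityPart {β : ℂ} (hβ : β ≠ 0) {k : ℕ} (hk : k < 2) :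
    ∃ C : ℂ, C ≠ 0 ∧ ∀ η : ℝ, 0 < η → ∃ f ∈ Fock, (∀ z, f (-z) = (-1) ^ k * f z) ∧
      iteratedDeriv k f 0 = C ∧
      fockNormSq (parityPart k (fockTranslate β f)) ≤ ENNReal.ofReal η := by
  have hb : 0 < ‖β‖ := norm_pos_iff.2 hβ
  obtain ⟨ω, hω⟩ : ∃ ω : Circle, (‖β‖ : ℂ) * ω = β :=
    ⟨Circle.exp β.arg, by rw [Circle.coe_exp]; exact Complex.norm_mul_exp_arg_mul_I β⟩
  set b := ‖β‖
  set c : ℝ := Real.pi / (2 * b) with hcdef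
  have hc : 0 < c := div_pos Real.pi_pos (by positivity)
  have hcb : c * b = Real.pi / 2 := by rw [hcdef]; field_simp
  refine ⟨((ω⁻¹ : Circle) : ℂ) ^ k * (c : ℂ) ^ k, mul_ne_zero (pow_ne_zero _ (Circle.coe_ne_zero _))
    (pow_ne_zero _ (by exact_mod_cast hc.ne')), fun η hη => ?_⟩
  set M := 8 * b ^ 2 * Real.exp (4 * c ^ 2 + 2 * b ^ 2) * (√(1 / 2))⁻¹ with hM
  have hM0 : 0 < M := by positivity
  -- The norm bound for `d = s ^ 2` is `M * s`.
  set s := min 1 (η / M) with hs_def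
  have hs : 0 < s := lt_min one_pos (by positivity)
  have hs1 : s ≤ 1 := min_le_left _ _
  have hf := quasiPeriodic_mem_fock hc.le (pow_pos hs 2) (pow_le_one₀ hs.le hs1) k
  refine ⟨fun z => quasiPeriodic c (s ^ 2) k ((ω⁻¹ : Circle) * z), ⟨?_, ?_⟩, fun z => ?_, ?_, ?_⟩
  · have := hf.1
    fun_prop
  · rw [fockNormSq_comp_rotation]
    exact hf.2
  · simp only [mul_neg, quasiPeriodic_neg]
  · have := hf.1.contDiff (n := k)
    rw [iteratedDeriv_comp_const_mul this]
    simp [iteratedDeriv_quasiPeriodic c _ hk]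
  · rw [← hω, fockTranslate_comp_rotation]
    simp_rw [funext (parityPart_comp_mul_left k (fockTranslate b (quasiPeriodic c (s ^ 2) k)) _)]
    rw [fockNormSq_comp_rotation]
    refine (fockNormSq_parityPart_fockTranslate_le hb hc hs hs1 hcb k).trans
      (ENNReal.ofReal_le_ofReal ?_)
    calc M * s ≤ M * (η / M) := by gcongr; exact min_le_right _ _
      _ = η := by field_simp

/-! ### Parity projections -/

theorem parityPart_mem_fock {f : ℂ → ℂ} (hf : f ∈ Fock) (k : ℕ) : parityPart k f ∈ Fock := by
  refine mem_fock_of_memLp ?_ ?_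
  · have := hf.1
    unfold parityPart
    fun_prop
  · have := ((Fock.memLp hf).add
      ((Fock.memLp (comp_neg_mem_fock hf)).const_mul ((-1) ^ k))).const_mul (2⁻¹ : ℂ)
    convert! this using 1
    funext z
    simp only [parityPart, Pi.add_apply]
    ring

theorem parityPart_eq_self {f : ℂ → ℂ} {k : ℕ} (hf : ∀ z, f (-z) = (-1) ^ k * f z) :
    parityPart k f = f := by
  funext z
  have : ((-1 : ℂ) ^ k) * (-1) ^ k = 1 := by rw [← mul_pow]; simp
  rw [parityPart, hf]
  linear_combination f z / 2 * this

theorem iteratedDeriv_parityPart {f : ℂ → ℂ} (hf : Differentiable ℂ f) (j k : ℕ) :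
    iteratedDeriv j (parityPart k f) 0 = (1 + (-1) ^ (k + j)) / 2 * iteratedDeriv j f 0 := by
  have h1 : ContDiffAt ℂ j f 0 := hf.contDiff.contDiffAt
  have h2 : ContDiffAt ℂ j (fun z => (-1) ^ k * f (-z)) 0 := by
    have : Differentiable ℂ (fun z => (-1) ^ k * f (-z)) := by fun_prop
    exact this.contDiff.contDiffAt
  have h3 : parityPart k f = fun z => (2⁻¹ : ℂ) * (f + fun z => (-1) ^ k * f (-z)) z := by
    funext z
    simp only [parityPart, Pi.add_apply]
    ring
  rw [h3, iteratedDeriv_const_mul_field, iteratedDeriv_add h1 h2, iteratedDeriv_const_mul_field,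
    iteratedDeriv_comp_neg, neg_zero, smul_eq_mul, pow_add]
  ring

theorem iteratedDeriv_parityPart_of_mod_eq {f : ℂ → ℂ} (hf : Differentiable ℂ f) {j k : ℕ}
    (h : j % 2 = k % 2) : iteratedDeriv j (parityPart k f) 0 = iteratedDeriv j f 0 := by
  have : Even (k + j) := by rw [Nat.even_iff]; omega
  rw [iteratedDeriv_parityPart hf, this.neg_one_pow]
  ring

theorem iteratedDeriv_parityPart_of_mod_ne {f : ℂ → ℂ} (hf : Differentiable ℂ f) {j k : ℕ}
    (h : j % 2 ≠ k % 2) : iteratedDeriv j (parityPart k f) 0 = 0 := by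
  have : Odd (k + j) := by rw [Nat.odd_iff]; omega
  rw [iteratedDeriv_parityPart hf, this.neg_one_pow]
  ring

theorem eq_of_iteratedDeriv_zero_eq {f g : ℂ → ℂ} (hf : Differentiable ℂ f)
    (hg : Differentiable ℂ g) (h : ∀ n, iteratedDeriv n f 0 = iteratedDeriv n g 0) : f = g := by
  funext z
  rw [← Complex.taylorSeries_eq_of_entire hf 0 z, ← Complex.taylorSeries_eq_of_entire hg 0 z]
  simp_rw [h]

/-- The projection is self-adjoint because the Gaussian measure is even. -/
theorem integral_parityPart_mul_conj {f g : ℂ → ℂ} (hf : f ∈ Fock) (hg : g ∈ Fock) (k : ℕ) :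
    ∫ z, parityPart k f z * conj (g z) ∂gaussianMeasure =
      ∫ z, f z * conj (parityPart k g z) ∂gaussianMeasure := by
  have hfn := comp_neg_mem_fock hf
  have hgn := comp_neg_mem_fock hg
  have h1 : ∀ z, parityPart k f z * conj (g z) =
      2⁻¹ * (f z * conj (g z)) + 2⁻¹ * (-1) ^ k * (f (-z) * conj (g z)) := fun z => by
    rw [parityPart]; ring
  have h2 : ∀ z, f z * conj (parityPart k g z) =
      2⁻¹ * (f z * conj (g z)) + 2⁻¹ * (-1) ^ k * (f z * conj (g (-z))) := fun z => by
    simp only [parityPart, map_div₀, map_add, map_mul, map_pow, map_neg, map_one, Complex.conj_ofNat]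
    ring
  simp_rw [h1, h2]
  rw [integral_add ((Fock.integrable_mul_conj hf hg).const_mul _)
      ((Fock.integrable_mul_conj hfn hg).const_mul _),
    integral_add ((Fock.integrable_mul_conj hf hg).const_mul _)
      ((Fock.integrable_mul_conj hf hgn).const_mul _),
    integral_const_mul, integral_const_mul, integral_const_mul,
    ← integral_gaussianMeasure_comp_neg fun z => f (-z) * conj (g z)]
  simp

theorem enorm_iteratedDeriv_sq_div_le {f : ℂ → ℂ} (hf : f ∈ Fock) (n : ℕ) :
    ‖iteratedDeriv n f 0‖ₑ ^ 2 / (n ! : ℝ≥0∞) ≤ fockNormSq f :=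
  (ENNReal.le_tsum n).trans (tsum_enorm_iteratedDeriv_sq_le hf)

/-! ### Failure of sampling and of interpolation -/

/-- Parity kills the sum over `E`, and Bessel's inequality bounds the sum over `Eᶜ`. -/
theorem deepNormSq_le_of_parity {E : Set ℕ} {k : ℕ} (hE : ∀ j, j ∈ E ↔ j % 2 ≠ k % 2) (β : ℂ)
    {f : ℂ → ℂ} (hf : f ∈ Fock) (hpar : ∀ z, f (-z) = (-1) ^ k * f z) :
    deepNormSq E β f ≤ fockNormSq (parityPart k (fockTranslate β f)) := by
  have hg := fockTranslate_mem_fock hf β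
  have h1 : ∀ j : E, ‖iteratedDeriv (j : ℕ) f 0‖ₑ ^ 2 / ((j : ℕ)! : ℝ≥0∞) = 0 := fun j => by
    rw [← parityPart_eq_self hpar,
      iteratedDeriv_parityPart_of_mod_ne hf.1 ((hE j).1 j.2)]
    simp
  have h2 : ∀ j : (Eᶜ : Set ℕ), iteratedDeriv (j : ℕ) (fockTranslate β f) 0 =
      iteratedDeriv (j : ℕ) (parityPart k (fockTranslate β f)) 0 := fun j => by
    rw [iteratedDeriv_parityPart_of_mod_eq hg.1]
    have := j.2
    rw [Set.mem_compl_iff, hE, not_not] at this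
    exact this
  unfold deepNormSq
  simp_rw [h1, h2]
  rw [tsum_zero, zero_add]
  exact (ENNReal.tsum_comp_le_tsum_of_injective Subtype.val_injective
    fun n : ℕ => ‖iteratedDeriv n (parityPart k (fockTranslate β f)) 0‖ₑ ^ 2 / (n ! : ℝ≥0∞)).trans
    (tsum_enorm_iteratedDeriv_sq_le (parityPart_mem_fock hg k))

theorem not_isDeepSampling_of_parity {E : Set ℕ} {k : ℕ} (hk : k < 2)
    (hE : ∀ j, j ∈ E ↔ j % 2 ≠ k % 2) {β : ℂ} (hβ : β ≠ 0) : ¬ IsDeepSampling E β := by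
  rintro ⟨ε, hε, h⟩
  obtain ⟨C, hC, hex⟩ := exists_small_parityPart hβ hk
  have hC' : 0 < ‖C‖ := norm_pos_iff.2 hC
  obtain ⟨f, hf, hpar, hfC, hsmall⟩ := hex (ε * ‖C‖ ^ 2 / 2) (by positivity)
  have h1 := enorm_iteratedDeriv_sq_div_le hf k
  have hfact : k ! = 1 := by interval_cases k <;> rfl
  rw [hfC, hfact, Nat.cast_one, div_one, ← ofReal_norm, ← ENNReal.ofReal_pow (norm_nonneg _)] at h1
  have h2 := ((mul_le_mul_right h1 (ENNReal.ofReal ε)).trans (h f hf)).trans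
    ((deepNormSq_le_of_parity hE β hf hpar).trans hsmall)
  rw [← ENNReal.ofReal_mul hε.le, ENNReal.ofReal_le_ofReal_iff (by positivity)] at h2
  have : 0 < ε * ‖C‖ ^ 2 := by positivity
  linarith

theorem not_isDeepInterpolation_of_parity {E : Set ℕ} {k : ℕ} (hk : k < 2)
    (hE : ∀ j, j ∈ E ↔ j % 2 = k % 2) {β : ℂ} (hβ : β ≠ 0) : ¬ IsDeepInterpolation E β := by
  intro h
  -- The data on `E` are those of `z ^ k`, as `k ! = 1`; the zero data force the translate to have
  -- parity `k`.
  obtain ⟨F, hF, hFa, hFb⟩ := h (fun j => if (j : ℕ) = k then 1 else 0) (fun _ => 0)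
    (summable_of_hasFiniteSupport ((Set.finite_singleton (⟨k, (hE k).2 rfl⟩ : E)).subset
      fun j hj => by
        by_contra hne
        have : (j : ℕ) ≠ k := fun hjk => hne (Subtype.ext hjk)
        simp [this] at hj))
    (by simp)
  have hG := fockTranslate_mem_fock hF β
  have hFpart : parityPart k F = fun z => z ^ k := by
    refine eq_of_iteratedDeriv_zero_eq (parityPart_mem_fock hF k).1 (by fun_prop) fun n => ?_
    rw [iteratedDeriv_fun_pow_zero]
    by_cases hn : n % 2 = k % 2
    · rw [iteratedDeriv_parityPart_of_mod_eq hF.1 hn, hFa ⟨n, (hE n).2 hn⟩]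
      interval_cases k <;> simp
    · rw [iteratedDeriv_parityPart_of_mod_ne hF.1 hn, if_neg (fun hnk : n = k => hn (by rw [hnk])),
        Nat.cast_zero]
  have hGpart : parityPart k (fockTranslate β F) = fockTranslate β F := by
    refine eq_of_iteratedDeriv_zero_eq (parityPart_mem_fock hG k).1 hG.1 fun n => ?_
    by_cases hn : n % 2 = k % 2
    · exact iteratedDeriv_parityPart_of_mod_eq hG.1 hn
    · rw [iteratedDeriv_parityPart_of_mod_ne hG.1 hn]
      exact (hFb ⟨n, fun hmem => hn ((hE n).1 hmem)⟩).symm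
  obtain ⟨C, hC, hex⟩ := exists_small_parityPart hβ hk
  have hC' : 0 < ‖C‖ := norm_pos_iff.2 hC
  set N := (fockNormSq F).toReal with hN
  have hN0 : 0 ≤ N := ENNReal.toReal_nonneg
  -- Chosen so that `N` times this is below `‖C‖ ^ 2`, even when `N = 0`.
  obtain ⟨f, hf, hpar, hfC, hsmall⟩ := hex (‖C‖ ^ 2 / (2 * (N + 1))) (by positivity)
  have hg := fockTranslate_mem_fock hf β
  -- The projection moves from `f` to `F`, leaving the pairing of `z ^ k` with `f`.
  have h1 : ∫ z, F z * conj (f z) ∂gaussianMeasure = conj C := by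
    rw [← hfC, ← integral_mul_conj_pow hf, ← integral_conj]
    nth_rewrite 1 [← parityPart_eq_self hpar]
    rw [← integral_parityPart_mul_conj hF hf, hFpart]
    simp [mul_comm]
  have h2 : ∫ z, F z * conj (f z) ∂gaussianMeasure =
      ∫ z, fockTranslate β F z * conj (parityPart k (fockTranslate β f) z) ∂gaussianMeasure := by
    rw [← integral_parityPart_mul_conj hG hg, hGpart, integral_fockTranslate_mul_conj]
  have h3 := norm_integral_mul_conj_sq_le hG (parityPart_mem_fock hg k)
  rw [← h2, h1, RCLike.norm_conj, fockNormSq_fockTranslate] at h3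
  have h4 := ENNReal.toReal_mono ENNReal.ofReal_ne_top hsmall
  rw [ENNReal.toReal_ofReal (by positivity)] at h4
  have h5 : ‖C‖ ^ 2 ≤ N * (‖C‖ ^ 2 / (2 * (N + 1))) := h3.trans (by gcongr)
  have h6 : N * (‖C‖ ^ 2 / (2 * (N + 1))) < ‖C‖ ^ 2 := by
    rw [← mul_div_assoc, div_lt_iff₀ (by positivity)]
    nlinarith [pow_pos hC' 2, mul_nonneg hN0 (pow_pos hC' 2).le]
  exact absurd h5 (not_le.2 h6)

end DeepZero

end

theorem theorem2 (E : Set ℕ) (hE : E = {n : ℕ | Even n} ∨ E = {n : ℕ | Odd n})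
    (β : ℂ) (hβ : β ≠ 0) :
    ¬ DeepZero.IsDeepInterpolation E β ∧ ¬ DeepZero.IsDeepSampling E β := by
  rcases hE with rfl | rfl
  -- Interpolation takes `k` of the parity of `E`, sampling of the opposite parity.
  · exact ⟨DeepZero.not_isDeepInterpolation_of_parity (k := 0) (by norm_num)
        (fun j => by simp [Nat.even_iff]) hβ,
      DeepZero.not_isDeepSampling_of_parity (k := 1) (by norm_num)
        (fun j => by simp [Nat.even_iff]) hβ⟩
  · exact ⟨DeepZero.not_isDeepInterpolation_of_parity (k := 1) (by norm_num)
        (fun j => by simp [Nat.odd_iff]) hβ,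
      DeepZero.not_isDeepSampling_of_parity (k := 0) (by norm_num)
        (fun j => by simp [Nat.odd_iff]) hβ⟩
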